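/- Let $A\in\mathcal M_n(\mathbb C)$ and let $J_{r_1}(\lambda_1)\oplus\dots\oplus J_{r_k}(\lambda_k)$ be a Jordan form of $A$; that is, $\lambda_1,\dots,\lambda_k\in\mathbb C$, $r_1,\dots,r_k\ge 1$, $r_1+\dots+r_k=n$, $J_{r}(\lambda)$ denotes the $r\times r$ Jordan block with $\lambda$ on the diagonal and $1$ on the first superdiagonal, and $P^{-1}AP=J_{r_1}(\lambda_1)\oplus\dots\oplus J_{r_k}(\lambda_k)$ for some invertible $P\in\mathcal M_n(\mathbb C)$. Put $$\mathcal K_A=\{(\alpha,\beta)\in\{1,\dots,k\}^2 : \lambda_\alpha+\overline{\lambda_\beta}=0\},$$ and consider the equation $A^HX+XA=0$ with unknown $X\in\mathcal M_n(\mathbb C)$, where $A^H$ is the conjugate transpose of $A$. (i) If $\mathcal K_A=\emptyset$, then $X=0$ is the only solution. (ii) If $\mathcal K_A\ne\emptyset$, then the complex vector space of all solutions has complex dimension $\sum_{(\alpha,\beta)\in\mathcal K_A}\min\{r_\alpha,r_\beta\}$. (iii) If $\mathcal K_A\ne\emptyset$, then the real vector space of all Hermitian solutions has real dimension $\sum_{(\alpha,\beta)\in\mathcal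 K_A}\min\{r_\alpha,r_\beta\}$. (iv) If $A$ has real entries and all its complex eigenvalues are real, then the real vector space of all real symmetric solutions has real dimension $$\sum_{(\alpha,\alpha)\in\mathcal K_A}\left\lfloor\frac{r_\alpha+1}{2}\right\rfloor+\sum_{\substack{(\alpha,\beta)\in\mathcal K_A\\ \alpha<\beta}}\min\{r_\alpha,r_\beta\}.$$ -/

import Mathlib

open Matrix

noncomputable section

/-- The upper triangular Jordan block of size `m` with eigenvalue `c`: the entries are `c` on the
diagonal, `1` on the first superdiagonal and `0` elsewhere. -/
def jordanBlock (m : ℕ) (c : ℂ) : Matrix (Fin m) (Fin m) ℂ :=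
  Matrix.of fun i j => if i = j then c else if (i : ℕ) + 1 = (j : ℕ) then 1 else 0

/-- The Jordan matrix `J_{r₁}(l₁) ⊕ ⋯ ⊕ J_{rₖ}(lₖ)`, the blocks being put along the diagonal in
the given order. -/
def jordanMatrix {k : ℕ} (r : Fin k → ℕ) (l : Fin k → ℂ) :
    Matrix (Fin (∑ a, r a)) (Fin (∑ a, r a)) ℂ :=
  Matrix.reindex finSigmaFinEquiv finSigmaFinEquiv
    (Matrix.blockDiagonal' fun a => jordanBlock (r a) (l a))

/-- `J_{r₁}(l₁) ⊕ ⋯ ⊕ J_{rₖ}(lₖ)` is a Jordan form of the complex matrix `A`: the block sizes are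
positive, they add up to the size of `A`, and `P⁻¹ A P` is this Jordan matrix for some invertible
complex matrix `P`. -/
def IsJordanForm {n k : ℕ} (A : Matrix (Fin n) (Fin n) ℂ) (r : Fin k → ℕ) (l : Fin k → ℂ) :
    Prop :=
  (∀ a, 0 < r a) ∧
    ∃ h : ∑ a, r a = n, ∃ P : Matrix (Fin n) (Fin n) ℂ, IsUnit P ∧
      P⁻¹ * A * P = Matrix.reindex (finCongr h) (finCongr h) (jordanMatrix r l)

/-- The set of the pairs `(a, b)` of block indices such that `l a + conj (l b) = 0`. -/
def lyapunovPairs {k : ℕ} (l : Fin k → ℂ) : Finset (Fin k × Fin k) :=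
  Finset.univ.filter fun p => l p.1 + star (l p.2) = 0

/-- The complex vector space of the solutions `X` of `Aᴴ X + X A = 0`. -/
def lyapunovSolutions {n : ℕ} (A : Matrix (Fin n) (Fin n) ℂ) :
    Submodule ℂ (Matrix (Fin n) (Fin n) ℂ) where
  carrier := {X | Aᴴ * X + X * A = 0}
  zero_mem' := by simp
  add_mem' := by
    intro X Y hX hY
    simp only [Set.mem_ofPred_eq] at hX hY ⊢
    rw [mul_add, add_mul, add_add_add_comm, hX, hY, add_zero]
  smul_mem' := by
    intro c X hX
    simp only [Set.mem_ofPred_eq] at hX ⊢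
    rw [Matrix.mul_smul, Matrix.smul_mul, ← smul_add, hX, smul_zero]

/-- The real vector space of the Hermitian solutions `X` of `Aᴴ X + X A = 0`. -/
def lyapunovHermitianSolutions {n : ℕ} (A : Matrix (Fin n) (Fin n) ℂ) :
    Submodule ℝ (Matrix (Fin n) (Fin n) ℂ) where
  carrier := {X | Aᴴ * X + X * A = 0 ∧ Xᴴ = X}
  zero_mem' := by simp
  add_mem' := by
    rintro X Y ⟨hX, hX'⟩ ⟨hY, hY'⟩
    refine ⟨?_, ?_⟩
    · rw [mul_add, add_mul, add_add_add_comm, hX, hY, add_zero]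
    · rw [Matrix.conjTranspose_add, hX', hY']
  smul_mem' := by
    rintro c X ⟨hX, hX'⟩
    refine ⟨?_, ?_⟩
    · rw [Matrix.mul_smul, Matrix.smul_mul, ← smul_add, hX, smul_zero]
    · rw [Matrix.conjTranspose_smul, hX', star_trivial]

/-- A complex matrix all of whose entries are real. -/
def IsRealMatrix {n : ℕ} (A : Matrix (Fin n) (Fin n) ℂ) : Prop :=
  ∀ i j, (A i j).im = 0

/-- The real vector space of the real symmetric solutions `X` of `Aᴴ X + X A = 0`. -/
def lyapunovRealSymmetricSolutions {n : ℕ} (A : Matrix (Fin n) (Fin n) ℂ) :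
    Submodule ℝ (Matrix (Fin n) (Fin n) ℂ) where
  carrier := {X | Aᴴ * X + X * A = 0 ∧ IsRealMatrix X ∧ Xᵀ = X}
  zero_mem' := by simp [IsRealMatrix]
  add_mem' := by
    rintro X Y ⟨hX, hX', hX''⟩ ⟨hY, hY', hY''⟩
    refine ⟨?_, ?_, ?_⟩
    · rw [mul_add, add_mul, add_add_add_comm, hX, hY, add_zero]
    · intro i j
      simp [hX' i j, hY' i j]
    · rw [Matrix.transpose_add, hX'', hY'']
  smul_mem' := by
    rintro c X ⟨hX, hX', hX''⟩
    refine ⟨?_, ?_, ?_⟩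
    · rw [Matrix.mul_smul, Matrix.smul_mul, ← smul_add, hX, smul_zero]
    · intro i j
      simp [hX' i j]
    · rw [Matrix.transpose_smul, hX'']

end

/-! ### Recursions on `ℕ × ℕ` -/

/-! If `A P = P J`, the congruence `X ↦ Pᴴ X P` turns the equation into `Jᴴ Y + Y J = 0`, which
decouples into one equation for each pair of Jordan blocks. Let `F p q` be the entry of a block at
distances `p`, `q` from its last row and column, extended by `0`. The equation becomes `c F(p,q) +
F(p+1,q) + F(p,q+1) = 0`, with `c` the sum of the two eigenvalues, one of them conjugated.

If `c ≠ 0`, descending induction on `p + q` gives `F = 0`. If `c = 0`, then `F` alternates in sign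
along each antidiagonal `p + q = t` and vanishes once `t ≥ min r s`, so the values `F 0 t` with `t <
min r s` are free coordinates (`finrank_sylvesterSolutions_jordanBlock`). Summing over pairs gives
(i) and (ii).

For (iii), the Hermitian solutions are a real form of the solution space (`finrank_real_form`). For
(iv), the real symmetric solutions are a real form of the complex symmetric solutions of `Aᵀ X + X A
= 0`. There the congruence uses `Pᵀ`, blocks above the diagonal are free, and symmetry of a diagonal
block kills the coordinates with odd `t`. -/

theorem recursion_eq_zero_of_ne {r s : ℕ} {c : ℂ} (hc : c ≠ 0) {F : ℕ → ℕ → ℂ}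
    (h0 : ∀ p q, r ≤ p ∨ s ≤ q → F p q = 0)
    (hF : ∀ p q, p < r → q < s → c * F p q + F (p + 1) q + F p (q + 1) = 0) (p q : ℕ) :
    F p q = 0 := by
  induction hm : (r + s) - (p + q) using Nat.strong_induction_on generalizing p q with
  | _ m ih =>
    by_cases h : r ≤ p ∨ s ≤ q
    · exact h0 p q h
    · push Not at h
      have h1 := ih _ (by omega) (p + 1) q rfl
      have h2 := ih _ (by omega) p (q + 1) rfl
      have h3 := hF p q h.1 h.2
      rw [h1, h2, add_zero, add_zero] at h3
      exact (mul_eq_zero.mp h3).resolve_left hc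

/-- Sliding along the antidiagonal changes only the sign. When `r ≤ p + q` the slide towards `q = 0`
leaves the matrix, and when `s ≤ p + q` the slide towards `p = 0` does. -/
theorem recursion_eq_zero_of_min_le {r s : ℕ} {F : ℕ → ℕ → ℂ}
    (h0 : ∀ p q, r ≤ p ∨ s ≤ q → F p q = 0)
    (hF : ∀ p q, p < r → q < s → F (p + 1) q + F p (q + 1) = 0) (p q : ℕ)
    (hpq : min r s ≤ p + q) : F p q = 0 := by
  rcases min_le_iff.mp hpq with h | h
  · induction q generalizing p with
    | zero => exact h0 _ _ (Or.inl h)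
    | succ q ih =>
      by_cases h' : r ≤ p ∨ s ≤ q + 1
      · exact h0 _ _ h'
      · push Not at h'
        have h1 := ih (p + 1) (by omega) (by omega)
        have h2 := hF p q h'.1 (by omega)
        rwa [h1, zero_add] at h2
  · induction p generalizing q with
    | zero => exact h0 _ _ (Or.inr (by omega))
    | succ p ih =>
      by_cases h' : r ≤ p + 1 ∨ s ≤ q
      · exact h0 _ _ h'
      · push Not at h'
        have h1 := ih (q + 1) (by omega) (by omega)
        have h2 := hF p q (by omega) h'.2
        rwa [h1, add_zero] at h2

theorem recursion_eq_antidiagonal {r s : ℕ} {F : ℕ → ℕ → ℂ}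
    (hF : ∀ p q, p < r → q < s → F (p + 1) q + F p (q + 1) = 0) (p q : ℕ)
    (hpq : p + q < min r s) : F p q = (-1) ^ p * F 0 (p + q) := by
  induction p generalizing q with
  | zero => simp
  | succ p ih =>
    have h1 := ih (q + 1) (by omega)
    have h2 := hF p q (by omega) (by omega)
    rw [h1] at h2
    rw [eq_neg_of_add_eq_zero_left h2, pow_succ, show p + (q + 1) = p + 1 + q by omega]
    ring

/-! ### The equation for a pair of Jordan blocks -/

/-- The solutions `X` of `M X + X N = 0`. -/
def sylvesterSolutions {m n : Type*} [Fintype m] [Fintype n] (M : Matrix m m ℂ)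
    (N : Matrix n n ℂ) : Submodule ℂ (Matrix m n ℂ) where
  carrier := {X | M * X + X * N = 0}
  zero_mem' := by simp
  add_mem' := by
    intro X Y hX hY
    simp only [Set.mem_ofPred_eq] at hX hY ⊢
    rw [Matrix.mul_add, Matrix.add_mul, add_add_add_comm, hX, hY, add_zero]
  smul_mem' := by
    intro c X hX
    simp only [Set.mem_ofPred_eq] at hX ⊢
    rw [Matrix.mul_smul, Matrix.smul_mul, ← smul_add, hX, smul_zero]

theorem mem_sylvesterSolutions {m n : Type*} [Fintype m] [Fintype n] {M : Matrix m m ℂ}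
    {N : Matrix n n ℂ} {X : Matrix m n ℂ} :
    X ∈ sylvesterSolutions M N ↔ M * X + X * N = 0 := Iff.rfl

/-- The entry of `X` at distance `p` from the last row and `q` from the last column, and `0` outside
of the matrix. -/
def revEntry {r s : ℕ} (X : Matrix (Fin r) (Fin s) ℂ) (p q : ℕ) : ℂ :=
  if h : p < r ∧ q < s then X ⟨r - 1 - p, by omega⟩ ⟨s - 1 - q, by omega⟩ else 0

theorem revEntry_eq_zero {r s : ℕ} (X : Matrix (Fin r) (Fin s) ℂ) (p q : ℕ) (h : r ≤ p ∨ s ≤ q) :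
    revEntry X p q = 0 := dif_neg (by omega)

theorem revEntry_rev {r s : ℕ} (X : Matrix (Fin r) (Fin s) ℂ) (i : Fin r) (j : Fin s) :
    revEntry X (r - 1 - i) (s - 1 - j) = X i j := by
  rw [revEntry, dif_pos (by omega)]
  congr 1 <;> ext <;> simp <;> omega

/-- The nilpotent part of the transposed block brings in the row above, which is distance `p + 1`
from the bottom. In the top row there is none, and the zero padding of `revEntry` keeps the formula
uniform. -/
theorem jordanBlock_transpose_mul_apply {r s : ℕ} (a : ℂ) (X : Matrix (Fin r) (Fin s) ℂ)
    {p q : ℕ} (hp : p < r) (hq : q < s) :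
    ((jordanBlock r a)ᵀ * X) ⟨r - 1 - p, by omega⟩ ⟨s - 1 - q, by omega⟩ =
      a * revEntry X p q + revEntry X (p + 1) q := by
  rw [Matrix.mul_apply]
  have hterm : ∀ x : Fin r, (jordanBlock r a)ᵀ ⟨r - 1 - p, by omega⟩ x =
      (if x = ⟨r - 1 - p, by omega⟩ then a else 0) +
        (if (x : ℕ) + 1 = r - 1 - p then 1 else 0) := by
    intro x
    simp only [transpose_apply, jordanBlock, of_apply, Fin.ext_iff]
    split_ifs <;> first | omega | simp
  simp only [hterm, add_mul, Finset.sum_add_distrib, ite_mul, zero_mul, one_mul,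
    Finset.sum_ite_eq', Finset.mem_univ, if_true]
  congr 1
  · rw [revEntry, dif_pos ⟨hp, hq⟩]
  · by_cases h : p + 1 < r
    · rw [revEntry, dif_pos ⟨h, hq⟩,
        Finset.sum_eq_single (⟨r - 1 - (p + 1), by omega⟩ : Fin r)]
      · rw [if_pos]; simp only; omega
      · intro b _ hb
        rw [if_neg]
        intro h'
        exact hb (Fin.ext (by simp only; omega))
      · simp
    · rw [revEntry_eq_zero _ _ _ (Or.inl (by omega))]
      exact Finset.sum_eq_zero fun x _ => if_neg (by omega)

theorem revEntry_transpose {r s : ℕ} (X : Matrix (Fin r) (Fin s) ℂ) (p q : ℕ) :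
    revEntry Xᵀ p q = revEntry X q p := by
  unfold revEntry
  by_cases h : p < s ∧ q < r
  · rw [dif_pos h, dif_pos h.symm, transpose_apply]
  · rw [dif_neg h, dif_neg fun h' => h h'.symm]

theorem mul_jordanBlock_apply {r s : ℕ} (b : ℂ) (X : Matrix (Fin r) (Fin s) ℂ)
    {p q : ℕ} (hp : p < r) (hq : q < s) :
    (X * jordanBlock s b) ⟨r - 1 - p, by omega⟩ ⟨s - 1 - q, by omega⟩ =
      b * revEntry X p q + revEntry X p (q + 1) := by
  have h := jordanBlock_transpose_mul_apply b Xᵀ hq hp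
  rwa [← transpose_mul, revEntry_transpose, revEntry_transpose, transpose_apply] at h

theorem mem_sylvesterSolutions_jordanBlock {r s : ℕ} {a b : ℂ} {X : Matrix (Fin r) (Fin s) ℂ} :
    X ∈ sylvesterSolutions (jordanBlock r a)ᵀ (jordanBlock s b) ↔
      ∀ p q, p < r → q < s →
        (a + b) * revEntry X p q + revEntry X (p + 1) q + revEntry X p (q + 1) = 0 := by
  rw [mem_sylvesterSolutions]
  constructor
  · intro h p q hp hq
    have := congrFun₂ h ⟨r - 1 - p, by omega⟩ ⟨s - 1 - q, by omega⟩
    rw [Matrix.add_apply, jordanBlock_transpose_mul_apply a X hp hq,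
      mul_jordanBlock_apply b X hp hq, Matrix.zero_apply] at this
    linear_combination this
  · intro h
    ext i j
    have hi : i = ⟨r - 1 - (r - 1 - i), by omega⟩ := by ext; simp only; omega
    have hj : j = ⟨s - 1 - (s - 1 - j), by omega⟩ := by ext; simp only; omega
    rw [hi, hj, Matrix.add_apply, jordanBlock_transpose_mul_apply a X (by omega) (by omega),
      mul_jordanBlock_apply b X (by omega) (by omega), Matrix.zero_apply]
    linear_combination h (r - 1 - i) (s - 1 - j) (by omega) (by omega)

theorem sylvesterSolutions_jordanBlock_of_ne {r s : ℕ} {a b : ℂ} (h : a + b ≠ 0) :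
    sylvesterSolutions (jordanBlock r a)ᵀ (jordanBlock s b) = ⊥ := by
  rw [eq_bot_iff]
  intro X hX
  rw [mem_sylvesterSolutions_jordanBlock] at hX
  rw [Submodule.mem_bot]
  ext i j
  rw [← revEntry_rev X i j]
  exact recursion_eq_zero_of_ne h (revEntry_eq_zero X) hX _ _

/-- The matrix whose entry at distances `p`, `q` from the last row and column is
`(-1) ^ p * y (p + q)`. -/
def alternatingHankel (r s : ℕ) (y : ℕ → ℂ) : Matrix (Fin r) (Fin s) ℂ :=
  Matrix.of fun i j => (-1) ^ (r - 1 - (i : ℕ)) * y ((r - 1 - i) + (s - 1 - j))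

/-- The bounds are non-strict because the recursion also reads the entries just outside the matrix,
`p = r` or `q = s`. There `p + q ≥ min r s`, so `y` vanishes. -/
theorem revEntry_alternatingHankel {r s : ℕ} {y : ℕ → ℂ} (hy : ∀ t, min r s ≤ t → y t = 0)
    {p q : ℕ} : revEntry (alternatingHankel r s y) p q =
      if p ≤ r ∧ q ≤ s then (-1) ^ p * y (p + q) else 0 := by
  unfold revEntry
  by_cases h : p < r ∧ q < s
  · rw [dif_pos h, if_pos ⟨h.1.le, h.2.le⟩]
    simp only [alternatingHankel, of_apply]
    rw [show r - 1 - (r - 1 - p) = p by omega, show s - 1 - (s - 1 - q) = q by omega]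
  · rw [dif_neg h]
    split_ifs
    · rw [hy _ (by omega), mul_zero]
    · rfl

theorem alternatingHankel_mem {r s : ℕ} {a b : ℂ} (h : a + b = 0) {y : ℕ → ℂ}
    (hy : ∀ t, min r s ≤ t → y t = 0) :
    alternatingHankel r s y ∈ sylvesterSolutions (jordanBlock r a)ᵀ (jordanBlock s b) := by
  rw [mem_sylvesterSolutions_jordanBlock]
  intro p q hp hq
  rw [h, zero_mul, zero_add, revEntry_alternatingHankel hy,
    revEntry_alternatingHankel hy, if_pos (by omega), if_pos (by omega),
    show p + 1 + q = p + (q + 1) by omega, pow_succ]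
  ring

theorem revEntry_eq_of_mem {r s : ℕ} {a b : ℂ} (h : a + b = 0) {X : Matrix (Fin r) (Fin s) ℂ}
    (hX : X ∈ sylvesterSolutions (jordanBlock r a)ᵀ (jordanBlock s b)) (p q : ℕ) :
    revEntry X p q = if p + q < min r s then (-1) ^ p * revEntry X 0 (p + q) else 0 := by
  rw [mem_sylvesterSolutions_jordanBlock] at hX
  simp only [h, zero_mul, zero_add] at hX
  split_ifs with hpq
  · exact recursion_eq_antidiagonal hX p q hpq
  · exact recursion_eq_zero_of_min_le (revEntry_eq_zero X) hX p q (not_lt.mp hpq)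

theorem matrix_ext_revEntry {r s : ℕ} {X Y : Matrix (Fin r) (Fin s) ℂ}
    (h : ∀ p q, p < r → q < s → revEntry X p q = revEntry Y p q) : X = Y := by
  ext i j
  rw [← revEntry_rev X, ← revEntry_rev Y, h _ _ (by omega) (by omega)]

theorem revEntry_add {r s : ℕ} (X Y : Matrix (Fin r) (Fin s) ℂ) (p q : ℕ) :
    revEntry (X + Y) p q = revEntry X p q + revEntry Y p q := by
  unfold revEntry; split_ifs <;> simp

theorem revEntry_smul {r s : ℕ} (c : ℂ) (X : Matrix (Fin r) (Fin s) ℂ) (p q : ℕ) :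
    revEntry (c • X) p q = c * revEntry X p q := by
  unfold revEntry; split_ifs <;> simp

theorem finrank_sylvesterSolutions_jordanBlock {r s : ℕ} {a b : ℂ} (h : a + b = 0) :
    Module.finrank ℂ (sylvesterSolutions (jordanBlock r a)ᵀ (jordanBlock s b)) = min r s := by
  -- The coordinates are the entries of the last row, read from the right.
  let f : sylvesterSolutions (jordanBlock r a)ᵀ (jordanBlock s b) →ₗ[ℂ] (Fin (min r s) → ℂ) :=
    { toFun := fun X t => revEntry X.1 0 t
      map_add' := fun X Y => funext fun t => revEntry_add _ _ _ _
      map_smul' := fun c X => funext fun t => revEntry_smul _ _ _ _ }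
  have hf : Function.Bijective f := by
    constructor
    · intro X Y hXY
      refine Subtype.ext (matrix_ext_revEntry fun p q _ _ => ?_)
      rw [revEntry_eq_of_mem h X.2, revEntry_eq_of_mem h Y.2]
      split_ifs with hpq
      · exact congrArg _ (congrFun hXY ⟨p + q, hpq⟩)
      · rfl
    · intro y
      let z : ℕ → ℂ := fun t => if h : t < min r s then y ⟨t, h⟩ else 0
      have hz : ∀ t, min r s ≤ t → z t = 0 := fun t ht => dif_neg (by omega)
      refine ⟨⟨_, alternatingHankel_mem h hz⟩, funext fun t => ?_⟩
      change revEntry (alternatingHankel r s z) 0 t = _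
      rw [revEntry_alternatingHankel hz, if_pos (by omega), zero_add, pow_zero, one_mul]
      exact dif_pos t.2
  rw [(LinearEquiv.ofBijective f hf).finrank_eq, Module.finrank_fin_fun]

/-- The solutions for a pair of Jordan blocks of size `r` and `s` which are symmetric, the symmetry
being phrased so that it makes sense for rectangular matrices. -/
def symmetricBlockSolutions (r s : ℕ) (a b : ℂ) : Submodule ℂ (Matrix (Fin r) (Fin s) ℂ) where
  carrier := {X | X ∈ sylvesterSolutions (jordanBlock r a)ᵀ (jordanBlock s b) ∧
    ∀ p q, revEntry X p q = revEntry X q p}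
  zero_mem' := ⟨zero_mem _, fun p q => by simp [revEntry]⟩
  add_mem' := by
    rintro X Y ⟨hX, hX'⟩ ⟨hY, hY'⟩
    exact ⟨add_mem hX hY, fun p q => by rw [revEntry_add, revEntry_add, hX', hY']⟩
  smul_mem' := by
    rintro c X ⟨hX, hX'⟩
    exact ⟨Submodule.smul_mem _ c hX, fun p q => by rw [revEntry_smul, revEntry_smul, hX']⟩

/-- Alternation gives `F t 0 = (-1) ^ t * F 0 t`, so symmetry forces `F 0 t = 0` for odd `t`. There
are `(r + 1) / 2` even numbers below `r`. -/
theorem finrank_symmetricBlockSolutions {r : ℕ} {a b : ℂ} (h : a + b = 0) :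
    Module.finrank ℂ (symmetricBlockSolutions r r a b) = (r + 1) / 2 := by
  let f : symmetricBlockSolutions r r a b →ₗ[ℂ] (Fin ((r + 1) / 2) → ℂ) :=
    { toFun := fun X t => revEntry X.1 0 (2 * t)
      map_add' := fun X Y => funext fun t => revEntry_add _ _ _ _
      map_smul' := fun c X => funext fun t => revEntry_smul _ _ _ _ }
  have hodd : ∀ X ∈ symmetricBlockSolutions r r a b, ∀ t, t < r → ¬ Even t →
      revEntry X 0 t = 0 := by
    intro X hX t ht hodd
    have h1 := revEntry_eq_of_mem h hX.1 t 0
    rw [add_zero, if_pos (by omega), (Nat.not_even_iff_odd.mp hodd).neg_one_pow, hX.2] at h1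
    linear_combination h1 / 2
  have hf : Function.Bijective f := by
    constructor
    · intro X Y hXY
      refine Subtype.ext (matrix_ext_revEntry fun p q _ _ => ?_)
      rw [revEntry_eq_of_mem h X.2.1, revEntry_eq_of_mem h Y.2.1]
      split_ifs with hpq
      · rw [min_self] at hpq
        by_cases he : Even (p + q)
        · obtain ⟨u, hu⟩ := he
          rw [show p + q = 2 * u by omega]
          exact congrArg _ (congrFun hXY ⟨u, by omega⟩)
        · rw [hodd _ X.2 _ hpq he, hodd _ Y.2 _ hpq he]
      · rfl
    · intro y
      let z : ℕ → ℂ := fun t =>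
        if h : t < r ∧ Even t then y ⟨t / 2, by omega⟩ else 0
      have hz : ∀ t, min r r ≤ t → z t = 0 := fun t ht => dif_neg (by omega)
      refine ⟨⟨alternatingHankel r r z, alternatingHankel_mem h hz, fun p q => ?_⟩,
        funext fun t => ?_⟩
      · rw [revEntry_alternatingHankel hz, revEntry_alternatingHankel hz, add_comm q p]
        simp only [and_comm (a := q ≤ r)]
        split_ifs
        · by_cases he : Even (p + q)
          -- As `p + q` is even, `p` and `q` have the same parity and the two signs agree.
          · congr 1
            rw [Nat.even_add] at he
            by_cases hp : Even p
            · rw [hp.neg_one_pow, (he.mp hp).neg_one_pow]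
            · rw [(Nat.not_even_iff_odd.mp hp).neg_one_pow,
                (Nat.not_even_iff_odd.mp (mt he.mpr hp)).neg_one_pow]
          · rw [show z (p + q) = 0 from dif_neg fun h => he h.2, mul_zero, mul_zero]
        · rfl
      · change revEntry (alternatingHankel r r z) 0 (2 * t) = _
        have ht : z (2 * t) = y t := by
          simp only [z]
          rw [dif_pos ⟨by omega, even_two_mul _⟩]
          congr 1
          ext
          simp
        rw [revEntry_alternatingHankel hz, if_pos (by omega), zero_add, ht, pow_zero, one_mul]
  rw [(LinearEquiv.ofBijective f hf).finrank_eq, Module.finrank_fin_fun]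

/-! ### Block diagonal matrices -/

section Block

variable {k : ℕ} {r : Fin k → ℕ}

/-- The block of a matrix in position `(a, b)`. -/
def sigmaBlock (X : Matrix (Σ a, Fin (r a)) (Σ a, Fin (r a)) ℂ) (a b : Fin k) :
    Matrix (Fin (r a)) (Fin (r b)) ℂ := Matrix.of fun i j => X ⟨a, i⟩ ⟨b, j⟩

theorem blockDiagonal'_mul_apply (D : ∀ a, Matrix (Fin (r a)) (Fin (r a)) ℂ)
    (X : Matrix (Σ a, Fin (r a)) (Σ a, Fin (r a)) ℂ) (a b : Fin k) (i : Fin (r a))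
    (j : Fin (r b)) :
    (blockDiagonal' D * X) ⟨a, i⟩ ⟨b, j⟩ = (D a * sigmaBlock X a b) i j := by
  rw [Matrix.mul_apply, Matrix.mul_apply, Fintype.sum_sigma, Finset.sum_eq_single a]
  · simp [sigmaBlock]
  · intro c _ hc
    exact Finset.sum_eq_zero fun x _ => by
      rw [blockDiagonal'_apply_ne _ _ _ hc.symm, zero_mul]
  · simp

theorem mul_blockDiagonal'_apply (D : ∀ a, Matrix (Fin (r a)) (Fin (r a)) ℂ)
    (X : Matrix (Σ a, Fin (r a)) (Σ a, Fin (r a)) ℂ) (a b : Fin k) (i : Fin (r a))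
    (j : Fin (r b)) :
    (X * blockDiagonal' D) ⟨a, i⟩ ⟨b, j⟩ = (sigmaBlock X a b * D b) i j := by
  rw [Matrix.mul_apply, Matrix.mul_apply, Fintype.sum_sigma, Finset.sum_eq_single b]
  · simp [sigmaBlock]
  · intro c _ hc
    exact Finset.sum_eq_zero fun x _ => by
      rw [blockDiagonal'_apply_ne _ _ _ hc, mul_zero]
  · simp

theorem mem_sylvesterSolutions_blockDiagonal' {D E : ∀ a, Matrix (Fin (r a)) (Fin (r a)) ℂ}
    {X : Matrix (Σ a, Fin (r a)) (Σ a, Fin (r a)) ℂ} :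
    X ∈ sylvesterSolutions (blockDiagonal' D) (blockDiagonal' E) ↔
      ∀ a b, sigmaBlock X a b ∈ sylvesterSolutions (D a) (E b) := by
  simp only [mem_sylvesterSolutions]
  constructor
  · intro h a b
    ext i j
    rw [Matrix.add_apply, ← blockDiagonal'_mul_apply, ← mul_blockDiagonal'_apply,
      ← Matrix.add_apply, h]
    rfl
  · intro h
    ext ⟨a, i⟩ ⟨b, j⟩
    rw [Matrix.add_apply, blockDiagonal'_mul_apply, mul_blockDiagonal'_apply, ← Matrix.add_apply, h]
    rfl

/-- The solutions of a block diagonal equation are the families of solutions of the equations for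
the pairs of blocks. -/
def sylvesterBlockEquiv (D E : ∀ a, Matrix (Fin (r a)) (Fin (r a)) ℂ) :
    sylvesterSolutions (blockDiagonal' D) (blockDiagonal' E) ≃ₗ[ℂ]
      (∀ p : Fin k × Fin k, sylvesterSolutions (D p.1) (E p.2)) where
  toFun X p := ⟨sigmaBlock X.1 p.1 p.2, mem_sylvesterSolutions_blockDiagonal'.mp X.2 p.1 p.2⟩
  map_add' _ _ := rfl
  map_smul' _ _ := rfl
  invFun Z := ⟨Matrix.of fun x y => (Z (x.1, y.1)).1 x.2 y.2,
    mem_sylvesterSolutions_blockDiagonal'.mpr fun a b => (Z (a, b)).2⟩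
  left_inv _ := rfl
  right_inv _ := rfl

/-- The direct sum of Jordan blocks, indexed by pairs. -/
def sigmaJordan (r : Fin k → ℕ) (l : Fin k → ℂ) :
    Matrix (Σ a, Fin (r a)) (Σ a, Fin (r a)) ℂ :=
  blockDiagonal' fun a => jordanBlock (r a) (l a)

theorem sigmaJordan_transpose (l : Fin k → ℂ) :
    (sigmaJordan r l)ᵀ = blockDiagonal' fun a => (jordanBlock (r a) (l a))ᵀ :=
  blockDiagonal'_transpose _

theorem jordanBlock_conjTranspose (m : ℕ) (c : ℂ) :
    (jordanBlock m c)ᴴ = (jordanBlock m (star c))ᵀ := by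
  ext i j
  simp only [jordanBlock, conjTranspose_apply, transpose_apply, of_apply]
  split_ifs <;> simp

theorem sigmaJordan_conjTranspose (l : Fin k → ℂ) :
    (sigmaJordan r l)ᴴ = (sigmaJordan r (star l))ᵀ := by
  rw [sigmaJordan_transpose, sigmaJordan, blockDiagonal'_conjTranspose]
  simp only [jordanBlock_conjTranspose, Pi.star_apply]

/-- Two independent eigenvalue families are allowed because `Jᴴ` is the transpose of the Jordan
matrix with conjugated eigenvalues. -/
theorem finrank_sylvesterSolutions_sigmaJordan (l m : Fin k → ℂ) :
    Module.finrank ℂ (sylvesterSolutions (sigmaJordan r l)ᵀ (sigmaJordan r m)) =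
      ∑ p : Fin k × Fin k with l p.1 + m p.2 = 0, min (r p.1) (r p.2) := by
  rw [sigmaJordan_transpose, sigmaJordan, (sylvesterBlockEquiv _ _).finrank_eq,
    Module.finrank_pi_fintype, Finset.sum_filter]
  refine Finset.sum_congr rfl fun p _ => ?_
  split_ifs with h
  · exact finrank_sylvesterSolutions_jordanBlock h
  · rw [sylvesterSolutions_jordanBlock_of_ne h, finrank_bot]

/-! ### Symmetric solutions -/

/-- The solutions `X` of `M X + X N = 0` with `Xᵀ = X`. -/
def symmetricSylvesterSolutions {n : Type*} [Fintype n] (M N : Matrix n n ℂ) :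
    Submodule ℂ (Matrix n n ℂ) where
  carrier := {X | X ∈ sylvesterSolutions M N ∧ Xᵀ = X}
  zero_mem' := ⟨zero_mem _, transpose_zero⟩
  add_mem' := by
    rintro X Y ⟨hX, hX'⟩ ⟨hY, hY'⟩
    exact ⟨add_mem hX hY, by rw [transpose_add, hX', hY']⟩
  smul_mem' := by
    rintro c X ⟨hX, hX'⟩
    exact ⟨Submodule.smul_mem _ c hX, by rw [transpose_smul, hX']⟩

theorem mem_symmetricSylvesterSolutions {n : Type*} [Fintype n] {M N X : Matrix n n ℂ} :
    X ∈ symmetricSylvesterSolutions M N ↔ X ∈ sylvesterSolutions M N ∧ Xᵀ = X := Iff.rfl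

/-- This gives the equation for block `(b, a)` from that for block `(a, b)`, so a symmetric solution
can be built from its upper blocks. -/
theorem transpose_mem_sylvesterSolutions {m n : Type*} [Fintype m] [Fintype n]
    {M : Matrix m m ℂ} {N : Matrix n n ℂ} {X : Matrix m n ℂ}
    (h : X ∈ sylvesterSolutions Mᵀ N) : Xᵀ ∈ sylvesterSolutions Nᵀ M := by
  rw [mem_sylvesterSolutions] at h ⊢
  have := congrArg transpose h
  rw [transpose_add, transpose_mul, transpose_mul, transpose_transpose, transpose_zero] at this
  rw [add_comm, this]

theorem sigmaBlock_transpose (X : Matrix (Σ a, Fin (r a)) (Σ a, Fin (r a)) ℂ) (a b : Fin k) :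
    sigmaBlock Xᵀ a b = (sigmaBlock X b a)ᵀ := rfl

/-- The possible blocks in position `p` of a symmetric solution. -/
def upperBlockSolutions (r : Fin k → ℕ) (l : Fin k → ℂ) (p : Fin k × Fin k) :
    Submodule ℂ (Matrix (Fin (r p.1)) (Fin (r p.2)) ℂ) :=
  if p.1 = p.2 then symmetricBlockSolutions (r p.1) (r p.2) (l p.1) (l p.2)
  else sylvesterSolutions (jordanBlock (r p.1) (l p.1))ᵀ (jordanBlock (r p.2) (l p.2))

theorem mem_upperBlockSolutions {l : Fin k → ℂ} {p : Fin k × Fin k}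
    {X : Matrix (Fin (r p.1)) (Fin (r p.2)) ℂ} :
    X ∈ upperBlockSolutions r l p ↔
      X ∈ sylvesterSolutions (jordanBlock (r p.1) (l p.1))ᵀ (jordanBlock (r p.2) (l p.2)) ∧
        (p.1 = p.2 → ∀ i j, revEntry X i j = revEntry X j i) := by
  unfold upperBlockSolutions
  split_ifs with h
  · exact ⟨fun hX => ⟨hX.1, fun _ => hX.2⟩, fun hX => ⟨hX.1, hX.2 h⟩⟩
  · exact ⟨fun hX => ⟨hX, fun h' => absurd h' h⟩, fun hX => hX.1⟩

/-- The symmetric matrix with given blocks on and above the diagonal. -/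
def symmetricOfBlocks
    (Z : ∀ p : {p : Fin k × Fin k // p.1 ≤ p.2}, Matrix (Fin (r p.1.1)) (Fin (r p.1.2)) ℂ) :
    Matrix (Σ a, Fin (r a)) (Σ a, Fin (r a)) ℂ :=
  Matrix.of fun x y => if h : x.1 ≤ y.1 then Z ⟨(x.1, y.1), h⟩ x.2 y.2
    else Z ⟨(y.1, x.1), (not_le.mp h).le⟩ y.2 x.2

theorem sigmaBlock_symmetricOfBlocks
    (Z : ∀ p : {p : Fin k × Fin k // p.1 ≤ p.2}, Matrix (Fin (r p.1.1)) (Fin (r p.1.2)) ℂ)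
    (p : {p : Fin k × Fin k // p.1 ≤ p.2}) :
    sigmaBlock (symmetricOfBlocks Z) p.1.1 p.1.2 = Z p := by
  ext i j
  simp only [sigmaBlock, symmetricOfBlocks, of_apply]
  rw [dif_pos p.2]

theorem matrix_transpose_eq_of_revEntry {m : ℕ} {X : Matrix (Fin m) (Fin m) ℂ}
    (h : ∀ i j, revEntry X i j = revEntry X j i) : Xᵀ = X :=
  matrix_ext_revEntry fun p q _ _ => by rw [revEntry_transpose, h]

theorem symmetricOfBlocks_transpose
    {Z : ∀ p : {p : Fin k × Fin k // p.1 ≤ p.2}, Matrix (Fin (r p.1.1)) (Fin (r p.1.2)) ℂ}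
    (hZ : ∀ a, (Z ⟨(a, a), le_refl a⟩)ᵀ = Z ⟨(a, a), le_refl a⟩) :
    (symmetricOfBlocks Z)ᵀ = symmetricOfBlocks Z := by
  ext ⟨a, i⟩ ⟨b, j⟩
  simp only [symmetricOfBlocks, transpose_apply, of_apply]
  rcases lt_trichotomy a b with h | h | h
  · rw [dif_neg (not_le.mpr h), dif_pos h.le]
  · subst h
    rw [dif_pos le_rfl, dif_pos le_rfl]
    exact congrFun₂ (hZ a) i j
  · rw [dif_pos h.le, dif_neg (not_le.mpr h)]

theorem symmetricOfBlocks_mem {l : Fin k → ℂ}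
    {Z : ∀ p : {p : Fin k × Fin k // p.1 ≤ p.2}, Matrix (Fin (r p.1.1)) (Fin (r p.1.2)) ℂ}
    (hZ : ∀ p, Z p ∈ upperBlockSolutions r l p.1) :
    symmetricOfBlocks Z ∈
      symmetricSylvesterSolutions (sigmaJordan r l)ᵀ (sigmaJordan r l) := by
  have hT : (symmetricOfBlocks Z)ᵀ = symmetricOfBlocks Z :=
    symmetricOfBlocks_transpose fun a =>
      matrix_transpose_eq_of_revEntry ((mem_upperBlockSolutions.mp (hZ ⟨(a, a), le_rfl⟩)).2 rfl)
  refine ⟨?_, hT⟩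
  rw [sigmaJordan_transpose, sigmaJordan, mem_sylvesterSolutions_blockDiagonal']
  intro a b
  rcases le_total a b with h | h
  · rw [sigmaBlock_symmetricOfBlocks Z ⟨(a, b), h⟩]
    exact (mem_upperBlockSolutions.mp (hZ ⟨(a, b), h⟩)).1
  · rw [← hT, sigmaBlock_transpose, sigmaBlock_symmetricOfBlocks Z ⟨(b, a), h⟩]
    exact transpose_mem_sylvesterSolutions (mem_upperBlockSolutions.mp (hZ ⟨(b, a), h⟩)).1

theorem sigmaBlock_mem_upperBlockSolutions {l : Fin k → ℂ}
    {X : Matrix (Σ a, Fin (r a)) (Σ a, Fin (r a)) ℂ}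
    (hX : X ∈ symmetricSylvesterSolutions (sigmaJordan r l)ᵀ (sigmaJordan r l))
    (p : Fin k × Fin k) : sigmaBlock X p.1 p.2 ∈ upperBlockSolutions r l p := by
  obtain ⟨hX, hT⟩ := hX
  rw [sigmaJordan_transpose, sigmaJordan, mem_sylvesterSolutions_blockDiagonal'] at hX
  refine mem_upperBlockSolutions.mpr ⟨hX p.1 p.2, ?_⟩
  obtain ⟨a, b⟩ := p
  rintro (rfl : a = b) i j
  rw [← revEntry_transpose, ← sigmaBlock_transpose, hT]

/-- Symmetric solutions are determined by their blocks on and above the diagonal. -/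
def symmetricSylvesterBlockEquiv (r : Fin k → ℕ) (l : Fin k → ℂ) :
    symmetricSylvesterSolutions (sigmaJordan r l)ᵀ (sigmaJordan r l) ≃ₗ[ℂ]
      (∀ p : {p : Fin k × Fin k // p.1 ≤ p.2}, upperBlockSolutions r l p.1) where
  toFun X p := ⟨sigmaBlock X.1 p.1.1 p.1.2, sigmaBlock_mem_upperBlockSolutions X.2 p.1⟩
  map_add' _ _ := rfl
  map_smul' _ _ := rfl
  invFun Z := ⟨symmetricOfBlocks fun p => (Z p).1, symmetricOfBlocks_mem fun p => (Z p).2⟩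
  left_inv X := by
    refine Subtype.ext ?_
    ext ⟨a, i⟩ ⟨b, j⟩
    simp only [symmetricOfBlocks, sigmaBlock, of_apply]
    split_ifs
    · rfl
    · exact congrFun₂ X.2.2 _ _
  right_inv Z := funext fun p => Subtype.ext (sigmaBlock_symmetricOfBlocks (fun p => (Z p).1) p)

theorem finrank_upperBlockSolutions (l : Fin k → ℂ) (p : Fin k × Fin k) :
    Module.finrank ℂ (upperBlockSolutions r l p) =
      if l p.1 + l p.2 = 0 then if p.1 = p.2 then (r p.1 + 1) / 2 else min (r p.1) (r p.2)
      else 0 := by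
  obtain ⟨a, b⟩ := p
  by_cases h : l a + l b = 0
  · rw [if_pos h]
    by_cases hab : a = b
    · subst hab
      rw [upperBlockSolutions, if_pos rfl, if_pos rfl]
      exact finrank_symmetricBlockSolutions h
    · rw [upperBlockSolutions, if_neg hab, if_neg hab]
      exact finrank_sylvesterSolutions_jordanBlock h
  · rw [if_neg h]
    have : upperBlockSolutions r l (a, b) = ⊥ := by
      rw [eq_bot_iff]
      intro X hX
      have := (mem_upperBlockSolutions.mp hX).1
      rwa [sylvesterSolutions_jordanBlock_of_ne h] at this
    rw [this, finrank_bot]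

theorem finrank_symmetricSylvesterSolutions_sigmaJordan (l : Fin k → ℂ) :
    Module.finrank ℂ (symmetricSylvesterSolutions (sigmaJordan r l)ᵀ (sigmaJordan r l)) =
      ∑ p : Fin k × Fin k with l p.1 + l p.2 = 0 ∧ p.1 = p.2, (r p.1 + 1) / 2 +
        ∑ p : Fin k × Fin k with l p.1 + l p.2 = 0 ∧ p.1 < p.2, min (r p.1) (r p.2) := by
  rw [(symmetricSylvesterBlockEquiv r l).finrank_eq, Module.finrank_pi_fintype]
  simp only [finrank_upperBlockSolutions]
  rw [← Finset.sum_subtype (Finset.univ.filter fun p : Fin k × Fin k => p.1 ≤ p.2) (by simp)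
      fun p => if l p.1 + l p.2 = 0 then if p.1 = p.2 then (r p.1 + 1) / 2
        else min (r p.1) (r p.2) else 0,
    Finset.sum_filter, Finset.sum_filter, Finset.sum_filter, ← Finset.sum_add_distrib]
  refine Finset.sum_congr rfl fun p _ => ?_
  by_cases h : l p.1 + l p.2 = 0
  · rcases lt_trichotomy p.1 p.2 with hp | hp | hp
    · simp [h, hp, hp.le, hp.ne]
    · rw [hp] at h
      simp [h, hp]
    · simp [h, hp.not_ge, hp.not_gt, hp.ne']
  · simp [h]

end Block

/-! ### Congruence -/

section Congruence

variable {m n : Type*} [Fintype m] [Fintype n] [DecidableEq n]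

/-- The linear equivalence `X ↦ U X P`, followed by a change of the index set. -/
def congruenceEquiv (e : m ≃ n) (U P : (Matrix n n ℂ)ˣ) : Matrix n n ℂ ≃ₗ[ℂ] Matrix m m ℂ where
  toFun X := (U.1 * X * P.1).submatrix e e
  map_add' X Y := by rw [Matrix.mul_add, Matrix.add_mul, submatrix_add]; rfl
  map_smul' c X := by rw [Matrix.mul_smul, Matrix.smul_mul, submatrix_smul]; rfl
  invFun Y := U⁻¹.1 * Y.submatrix e.symm e.symm * P⁻¹.1
  left_inv X := by
    simp [Matrix.mul_assoc]
  right_inv Y := by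
    simp [Matrix.mul_assoc]

/-- `U` is kept independent of `P` so that both `Pᴴ` and `Pᵀ` can be used. -/
theorem congruenceEquiv_mem_iff (e : m ≃ n) (U P : (Matrix n n ℂ)ˣ) {M N X : Matrix n n ℂ}
    {M' N' : Matrix m m ℂ} (hM : U.1 * M = M'.submatrix e.symm e.symm * U.1)
    (hN : N * P.1 = P.1 * N'.submatrix e.symm e.symm) :
    congruenceEquiv e U P X ∈ sylvesterSolutions M' N' ↔ X ∈ sylvesterSolutions M N := by
  have key : M' * congruenceEquiv e U P X + congruenceEquiv e U P X * N' =
      congruenceEquiv e U P (M * X + X * N) := by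
    change M' * (U.1 * X * P.1).submatrix e e + (U.1 * X * P.1).submatrix e e * N' =
      (U.1 * (M * X + X * N) * P.1).submatrix e e
    have h1 : M' = (M'.submatrix e.symm e.symm).submatrix e e := by simp
    have h2 : N' = (N'.submatrix e.symm e.symm).submatrix e e := by simp
    conv_lhs => rw [h1, h2]
    rw [submatrix_mul_equiv, submatrix_mul_equiv, Matrix.mul_assoc _ P.1, ← hN,
      ← Matrix.mul_assoc, ← Matrix.mul_assoc, ← hM, Matrix.mul_add, Matrix.add_mul,
      submatrix_add]
    simp only [Matrix.mul_assoc]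
    rfl
  rw [mem_sylvesterSolutions, key, mem_sylvesterSolutions]
  exact LinearEquiv.map_eq_zero_iff _

theorem finrank_eq_of_equiv {V W : Type*} [AddCommGroup V] [AddCommGroup W] [Module ℂ V]
    [Module ℂ W] (f : V ≃ₗ[ℂ] W) (S : Submodule ℂ V) (T : Submodule ℂ W)
    (h : ∀ x, f x ∈ T ↔ x ∈ S) : Module.finrank ℂ S = Module.finrank ℂ T := by
  have : S = T.comap f.toLinearMap := by ext x; exact (h x).symm
  subst this
  exact (f.ofSubmodule' T).finrank_eq

end Congruence

/-! ### Real forms -/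

/-- Every `X` in `S` is uniquely `Y + iZ` with `Y`, `Z` Hermitian in `S`. Hence `H × H` is
isomorphic to `S` over the reals, and both dimensions double. -/
theorem finrank_real_form {n : Type*} [Fintype n] (S : Submodule ℂ (Matrix n n ℂ))
    (H : Submodule ℝ (Matrix n n ℂ)) (hS : ∀ X ∈ S, Xᴴ ∈ S)
    (hH : ∀ X, X ∈ H ↔ X ∈ S ∧ Xᴴ = X) : Module.finrank ℝ H = Module.finrank ℂ S := by
  have hI : ∀ X ∈ H, ∀ Y ∈ H, X + Complex.I • Y ∈ S := fun X hX Y hY =>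
    add_mem ((hH X).mp hX).1 (Submodule.smul_mem _ _ ((hH Y).mp hY).1)
  let f : (H × H) →ₗ[ℝ] S :=
    { toFun := fun Z => ⟨Z.1.1 + Complex.I • Z.2.1, hI _ Z.1.2 _ Z.2.2⟩
      map_add' := fun Z W => Subtype.ext (by
        simp only [Prod.fst_add, Prod.snd_add, Submodule.coe_add, smul_add]; abel)
      map_smul' := fun c Z => Subtype.ext (by
        change c • Z.1.1 + Complex.I • c • Z.2.1 = c • (Z.1.1 + Complex.I • Z.2.1)
        rw [smul_add, smul_comm]) }
  have hf : Function.Bijective f := by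
    constructor
    · rw [← LinearMap.ker_eq_bot, LinearMap.ker_eq_bot']
      rintro ⟨⟨X, hX⟩, ⟨Y, hY⟩⟩ h
      have h1 : X + Complex.I • Y = 0 := congrArg Subtype.val h
      have h2 := congrArg conjTranspose h1
      rw [conjTranspose_add, conjTranspose_smul, ((hH X).mp hX).2, ((hH Y).mp hY).2,
        conjTranspose_zero, Complex.star_def, Complex.conj_I, neg_smul] at h2
      have hX0 : X = 0 := by
        have : (2 : ℂ) • X = 0 := by
          rw [two_smul]
          calc X + X = (X + Complex.I • Y) + (X + -(Complex.I • Y)) := by abel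
            _ = 0 := by rw [h1, h2, add_zero]
        exact (smul_eq_zero.mp this).resolve_left two_ne_zero
      subst hX0
      rw [zero_add] at h1
      obtain rfl := (smul_eq_zero.mp h1).resolve_left Complex.I_ne_zero
      rfl
    · rintro ⟨X, hX⟩
      have hA : (2⁻¹ : ℂ) • (X + Xᴴ) ∈ H := (hH _).mpr
        ⟨S.smul_mem _ (add_mem hX (hS X hX)), by
          rw [conjTranspose_smul, conjTranspose_add, conjTranspose_conjTranspose, add_comm Xᴴ]
          simp⟩
      -- The scalar is `1 / (2i)`.
      have hB : (-Complex.I / 2) • (X - Xᴴ) ∈ H := (hH _).mpr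
        ⟨S.smul_mem _ (sub_mem hX (hS X hX)), by
          rw [conjTranspose_smul, conjTranspose_sub, conjTranspose_conjTranspose,
            ← neg_sub X Xᴴ, smul_neg, ← neg_smul]
          congr 1
          simp [neg_div]⟩
      refine ⟨(⟨_, hA⟩, ⟨_, hB⟩), Subtype.ext ?_⟩
      change (2⁻¹ : ℂ) • (X + Xᴴ) + Complex.I • (-Complex.I / 2) • (X - Xᴴ) = X
      rw [smul_smul, show Complex.I * (-Complex.I / 2) = 2⁻¹ by
        linear_combination (-1 / 2 : ℂ) * Complex.I_mul_I, ← smul_add]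
      rw [show X + Xᴴ + (X - Xᴴ) = (2 : ℂ) • X by rw [two_smul]; abel, smul_smul]
      simp
  have h1 := (LinearEquiv.ofBijective f hf).finrank_eq
  rw [Module.finrank_prod, finrank_real_of_complex] at h1
  omega

/-! ### The equation for a matrix with given Jordan form -/

section Main

variable {n k : ℕ} {A : Matrix (Fin n) (Fin n) ℂ} {r : Fin k → ℕ} {l : Fin k → ℂ}

theorem IsJordanForm.exists_equiv (hJ : IsJordanForm A r l) :
    ∃ (e : (Σ a, Fin (r a)) ≃ Fin n) (P : (Matrix (Fin n) (Fin n) ℂ)ˣ),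
      A * P.1 = P.1 * (sigmaJordan r l).submatrix e.symm e.symm := by
  obtain ⟨-, h, P, hP, hA⟩ := hJ
  refine ⟨finSigmaFinEquiv.trans (finCongr h), hP.unit, ?_⟩
  have hdet := (Matrix.isUnit_iff_isUnit_det P).mp hP
  change A * P = P * _
  rw [← Matrix.mul_nonsing_inv_cancel_left P (A * P) hdet, ← Matrix.mul_assoc P⁻¹, hA]
  rfl

/-- The first basis vector of block `a` is an eigenvector of the Jordan matrix; it exists because
the block sizes are positive. -/
theorem IsJordanForm.mem_spectrum (hJ : IsJordanForm A r l) (a : Fin k) : l a ∈ spectrum ℂ A := by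
  obtain ⟨e, P, hP⟩ := hJ.exists_equiv
  have h0 : sigmaJordan r l *ᵥ Pi.single ⟨a, ⟨0, hJ.1 a⟩⟩ 1 =
      l a • Pi.single ⟨a, ⟨0, hJ.1 a⟩⟩ 1 := by
    ext ⟨b, i⟩
    rw [mulVec_single_one]
    by_cases hab : b = a
    · subst hab
      simp only [sigmaJordan, Matrix.col_apply, blockDiagonal'_apply_eq, jordanBlock, of_apply,
        Pi.smul_apply, Pi.single_apply, Sigma.mk.injEq, heq_eq_eq, true_and]
      split_ifs <;> simp_all
    · rw [Matrix.col_apply, sigmaJordan, blockDiagonal'_apply_ne _ _ _ hab]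
      simp [hab]
  rw [spectrum.mem_iff, Matrix.isUnit_iff_isUnit_det, isUnit_iff_ne_zero, not_not,
    ← Matrix.exists_mulVec_eq_zero_iff]
  set v : (Σ a, Fin (r a)) → ℂ := Pi.single ⟨a, ⟨0, hJ.1 a⟩⟩ 1 with hv
  have hvne : v ≠ 0 := by simp [hv]
  refine ⟨P.1 *ᵥ (v ∘ e.symm), ?_, ?_⟩
  · intro h
    apply hvne
    have h2 := congrArg (fun w => P⁻¹.1 *ᵥ w) h
    simp only [mulVec_mulVec, Units.inv_mul, one_mulVec, mulVec_zero] at h2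
    ext x
    simpa using congrFun h2 (e x)
  · rw [sub_mulVec, mulVec_mulVec _ A, hP, ← mulVec_mulVec, submatrix_mulVec_equiv]
    simp only [Function.comp_assoc, Equiv.symm_symm, Equiv.symm_comp_self, Function.comp_id, h0]
    rw [Algebra.algebraMap_eq_smul_one, smul_mulVec, one_mulVec, ← mulVec_smul, sub_eq_zero]
    rfl

theorem finrank_lyapunovSolutions (hJ : IsJordanForm A r l) :
    Module.finrank ℂ (lyapunovSolutions A) =
      ∑ p ∈ lyapunovPairs l, min (r p.1) (r p.2) := by
  obtain ⟨e, P, hP⟩ := hJ.exists_equiv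
  have hU : (star P).1 * Aᴴ = (sigmaJordan r (star l))ᵀ.submatrix e.symm e.symm * (star P).1 := by
    have := congrArg conjTranspose hP
    rwa [conjTranspose_mul, conjTranspose_mul, conjTranspose_submatrix,
      sigmaJordan_conjTranspose] at this
  rw [finrank_eq_of_equiv (congruenceEquiv e (star P) P) (lyapunovSolutions A) _
      fun X => congruenceEquiv_mem_iff e (star P) P hU hP,
    finrank_sylvesterSolutions_sigmaJordan]
  refine Finset.sum_congr (Finset.filter_congr fun p _ => ?_) fun _ _ => rfl
  -- The two conditions on a pair are complex conjugates of each other.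
  rw [Pi.star_apply, ← star_eq_zero, star_add, star_star]

theorem finrank_lyapunovHermitianSolutions (A : Matrix (Fin n) (Fin n) ℂ) :
    Module.finrank ℝ (lyapunovHermitianSolutions A) =
      Module.finrank ℂ (lyapunovSolutions A) := by
  refine finrank_real_form _ _ (fun X hX => ?_) fun X => Iff.rfl
  have h := congrArg conjTranspose (show Aᴴ * X + X * A = 0 from hX)
  rw [conjTranspose_add, conjTranspose_mul, conjTranspose_mul, conjTranspose_conjTranspose,
    conjTranspose_zero, add_comm] at h
  exact h

/-- Congruence by `Pᵀ` commutes with transposition, so it preserves symmetry even though `P` may not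
be real. -/
theorem finrank_symmetricSylvesterSolutions (hJ : IsJordanForm A r l) :
    Module.finrank ℂ (symmetricSylvesterSolutions Aᵀ A) =
      ∑ p : Fin k × Fin k with l p.1 + l p.2 = 0 ∧ p.1 = p.2, (r p.1 + 1) / 2 +
        ∑ p : Fin k × Fin k with l p.1 + l p.2 = 0 ∧ p.1 < p.2, min (r p.1) (r p.2) := by
  obtain ⟨e, P, hP⟩ := hJ.exists_equiv
  let U : (Matrix (Fin n) (Fin n) ℂ)ˣ :=
    ⟨P.1ᵀ, P⁻¹.1ᵀ, by rw [← transpose_mul, Units.inv_mul, transpose_one],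
      by rw [← transpose_mul, Units.mul_inv, transpose_one]⟩
  have hU : U.1 * Aᵀ = (sigmaJordan r l)ᵀ.submatrix e.symm e.symm * U.1 := by
    have := congrArg transpose hP
    rwa [transpose_mul, transpose_mul, transpose_submatrix] at this
  have hsymm : ∀ X, (congruenceEquiv e U P X)ᵀ = congruenceEquiv e U P Xᵀ := by
    intro X
    change ((P.1ᵀ * X * P.1).submatrix e e)ᵀ = (P.1ᵀ * Xᵀ * P.1).submatrix e e
    rw [transpose_submatrix, transpose_mul, transpose_mul, transpose_transpose, Matrix.mul_assoc]
  rw [finrank_eq_of_equiv (congruenceEquiv e U P) _ _ fun X => ?_,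
    finrank_symmetricSylvesterSolutions_sigmaJordan]
  rw [mem_symmetricSylvesterSolutions, mem_symmetricSylvesterSolutions, hsymm,
    (congruenceEquiv e U P).injective.eq_iff, congruenceEquiv_mem_iff e U P hU hP]

theorem IsRealMatrix.conjTranspose_eq {X : Matrix (Fin n) (Fin n) ℂ} (hX : IsRealMatrix X) :
    Xᴴ = Xᵀ := by
  ext i j
  exact Complex.conj_eq_iff_im.mpr (hX j i)

/-- A symmetric matrix is Hermitian exactly when it is real, so `finrank_real_form` applies and no
real Jordan basis is needed. -/
theorem finrank_lyapunovRealSymmetricSolutions (hA : IsRealMatrix A) :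
    Module.finrank ℝ (lyapunovRealSymmetricSolutions A) =
      Module.finrank ℂ (symmetricSylvesterSolutions Aᵀ A) := by
  have hAT : Aᵀᴴ = A := by rw [← hA.conjTranspose_eq, conjTranspose_conjTranspose]
  refine finrank_real_form _ _ ?_ fun X => ?_
  · rintro X ⟨hX, hX'⟩
    refine ⟨?_, (congrArg conjTranspose hX' : Xᵀᴴ = Xᴴ)⟩
    have h := congrArg conjTranspose (mem_sylvesterSolutions.mp hX)
    rw [conjTranspose_add, conjTranspose_mul, conjTranspose_mul, hAT, hA.conjTranspose_eq,
      conjTranspose_zero, add_comm] at h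
    exact h
  · rw [← hA.conjTranspose_eq]
    constructor
    · rintro ⟨h1, h2, h3⟩
      exact ⟨⟨h1, h3⟩, h2.conjTranspose_eq.trans h3⟩
    · rintro ⟨⟨h1, h3⟩, h2⟩
      refine ⟨h1, fun i j => ?_, h3⟩
      exact Complex.conj_eq_iff_im.mp ((congrFun₂ h2 j i).trans (congrFun₂ h3 i j))

end Main

theorem mainTheorem1 {n k : ℕ} (A : Matrix (Fin n) (Fin n) ℂ) (r : Fin k → ℕ) (l : Fin k → ℂ)
    (hJ : IsJordanForm A r l) :
    (lyapunovPairs l = ∅ → lyapunovSolutions A = ⊥) ∧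
    ((lyapunovPairs l).Nonempty →
      Module.finrank ℂ (lyapunovSolutions A) = ∑ p ∈ lyapunovPairs l, min (r p.1) (r p.2)) ∧
    ((lyapunovPairs l).Nonempty →
      Module.finrank ℝ (lyapunovHermitianSolutions A) =
        ∑ p ∈ lyapunovPairs l, min (r p.1) (r p.2)) ∧
    (IsRealMatrix A → (∀ z ∈ spectrum ℂ A, z.im = 0) →
      Module.finrank ℝ (lyapunovRealSymmetricSolutions A) =
        ∑ p ∈ (lyapunovPairs l).filter (fun p => p.1 = p.2), (r p.1 + 1) / 2 +
          ∑ p ∈ (lyapunovPairs l).filter (fun p => p.1 < p.2), min (r p.1) (r p.2)) := by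
  have hfin := finrank_lyapunovSolutions hJ
  refine ⟨fun h => ?_, fun _ => hfin, fun _ => ?_, fun hA hspec => ?_⟩
  · rw [h, Finset.sum_empty] at hfin
    exact Submodule.finrank_eq_zero.mp hfin
  · rw [finrank_lyapunovHermitianSolutions, hfin]
  -- Real eigenvalues make the pair conditions with and without conjugation coincide.
  · have hl : ∀ a, star (l a) = l a := fun a =>
      Complex.conj_eq_iff_im.mpr (hspec _ (hJ.mem_spectrum a))
    rw [finrank_lyapunovRealSymmetricSolutions hA, finrank_symmetricSylvesterSolutions hJ,
      lyapunovPairs, Finset.filter_filter, Finset.filter_filter]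
    simp only [hl]
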